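/- Let $S$ be a Noetherian integrally closed domain whose fraction field $L$ has characteristic $0$, such that $2$ is a prime element of $S$ and $S/2S$ is integrally closed. Call $x\in S$ square free if $QS_Q=xS_Q$ for every height one prime $Q\subset S$ containing $x$. Let $f,g\in S$ be square free elements that are not squares in $S$ and such that no height one prime of $S$ contains both $f$ and $g$. Assume that $f=h_1^2+2a$ and $g=h_2^2+2b$ with $h_1,h_2,a,b\in S$. Let $K=L(\omega,\mu)$, where $\omega^2=f$, $\mu^2=g$ and $U^2-g$ is irreducible over $L(\omega)$ (so $[K:L]=4$). Let $R$ be the integral closure of $S$ in $K$, let $A=S[\omega,\mu]$, and put $S^{2\wedge 4}=\{x^2+4y : x,y\in S\}$. Suppose that $S[\omega]$ and $S[\mu]$ are integrally closed and that $fg\notin S^{2\wedge 4}$. Let $\tau=(\mu-h_2)(\omega-h_1)/2\in K$. Then $R=S[\omega,\mu,\tau]$, and $R$ is a free $S$-module with basis $\{1,\omega,\mu,\tau\}$. Moreover, $A$ has a unique height one prime $P$ containing $2$, and $P^*:=\{x\in K : xP\subseteq A\}$ equals $R$, and $P$ is the conductor $\{x\in A : xR\subseteq A\}$ of $R$ into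 $A$. -/

import Mathlib

open scoped Polynomial IntermediateField

namespace Biquadratic

/-- The multiplicative subset `S^{p^k ∧ p^n}` of `S`: all elements of the form
`x ^ (p ^ k) + y * p ^ n` with `x, y ∈ S`. -/
def powWedge (S : Type*) [CommRing S] (p k n : ℕ) : Set S :=
  {s | ∃ x y : S, s = x ^ (p ^ k) + y * (p : S) ^ n}

/-- `x` is square free: `Q S_Q = x S_Q` for every height one prime `Q` containing `x`. -/
def IsSquareFree {S : Type*} [CommRing S] (x : S) : Prop :=
  ∀ (Q : Ideal S) [Q.IsPrime], Q.height = 1 → x ∈ Q →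
    Q.map (algebraMap S (Localization.AtPrime Q)) =
      Ideal.span {algebraMap S (Localization.AtPrime Q) x}

/-- Condition `𝒜₁` on a subset `W`: no two distinct elements of `W` lie in a common height one
prime. -/
def SatisfiesA1 {S : Type*} [CommRing S] (W : Set S) : Prop :=
  ∀ x ∈ W, ∀ y ∈ W, x ≠ y →
    ¬ ∃ Q : Ideal S, Q.IsPrime ∧ Q.height = 1 ∧ x ∈ Q ∧ y ∈ Q

/-- For an ideal `I` of `A` and an `A`-algebra `K` (a field containing `A`, in practice the
fraction field), the dual `I^* = (A :_K I) = {x ∈ K | x I ⊆ A}`. -/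
noncomputable def dual {A : Type*} [CommRing A] (K : Type*) [CommRing K] [Algebra A K]
    (I : Ideal A) : Submodule A K :=
  1 / IsLocalization.coeSubmodule K I

/-- The conductor of `B` into `A`, for subalgebras `A, B` of `K`: the ideal
`{x ∈ A | x B ⊆ A}` of `A`. -/
def conductorInto {S K : Type*} [CommRing S] [CommRing K] [Algebra S K]
    (B A : Subalgebra S K) : Ideal A where
  carrier := {x | ∀ r ∈ B, (x : K) * r ∈ A}
  add_mem' := by
    intro x y hx hy r hr
    have h : ((x + y : A) : K) * r = x * r + y * r := by push_cast; ring
    rw [h]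
    exact A.add_mem (hx r hr) (hy r hr)
  zero_mem' := by
    intro r _
    simp
  smul_mem' := by
    intro c x hx r hr
    have h : ((c • x : A) : K) * r = c * (x * r) := by
      rw [smul_eq_mul]; push_cast; ring
    rw [h]
    exact A.mul_mem c.2 (hx r hr)

end Biquadratic

/-! Put `α = ω - h₁` and `β = μ - h₂`. Then `A = S[α, β]`, `α² = 2(a - h₁α)`, `β² = 2(b - h₂β)` and
`τ = αβ/2`. Completing the square, `(τ - h₁h₂)²` lies in `A`, so `τ` is integral.

For the reverse inclusion, traces to `L(ω)` and `L(μ)`, together with the absence of a common height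
one prime of `f` and `g`, give `2R ⊆ A` (`IndepQuad.two_mul_mem_adjoin`). So an integral `x` is half
a combination of `1, α, β, αβ`. Subtracting a multiple of `τ` and squaring repeatedly gives
congruences modulo `2` on the coefficients. These force the coefficients of `1, α, β` to be even
(`exists_coords_of_isIntegral`), provided `a`, `b` and `ah₂² + bh₁²` are odd. The first two are odd
because `S[ω]` and `S[μ]` are integrally closed, the third because `fg = (h₁h₂)² + 2(ah₂² + bh₁²) +
4ab` is not in `S^{2∧4}`.

Modulo `2` both `α` and `β` are nilpotent, so every prime of `A` over `2` contains `P = (2, α, β)`,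
the elements with even constant coordinate. Comparing coordinates shows that `P^*` is spanned by `1,
α, β, αβ/2`, hence is `R`, and that `x ∈ A` satisfies `xτ ∈ A` exactly when `x ∈ P`. -/

namespace Biquadratic

/-! ### Height one primes containing colon ideals. -/

/-- In a Noetherian integrally closed domain, every proper colon ideal `(q : p)` is contained in a
height one prime. -/
theorem exists_height_one_of_not_dvd {S : Type*} [CommRing S] [IsDomain S] [IsNoetherianRing S]
    [IsIntegrallyClosed S] {p q : S} (hq : q ≠ 0) (hpq : ¬ q ∣ p) :
    ∃ Q : Ideal S, Q.IsPrime ∧ Q.height = 1 ∧ ∀ r, q ∣ r * p → r ∈ Q := by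
  have hx : (Ideal.Quotient.mk (Ideal.span {q}) p) ≠ 0 := by
    rwa [Ne, Ideal.Quotient.eq_zero_iff_mem, Ideal.mem_span_singleton]
  obtain ⟨P, hP, hle⟩ := exists_le_isAssociatedPrime_of_isNoetherianRing S _ hx
  obtain ⟨hPp, y, hy⟩ := isAssociatedPrime_iff.1 hP
  obtain ⟨p', rfl⟩ := Ideal.Quotient.mk_surjective y
  have hcol : ∀ z r : S, r ∈ (⊥ : Submodule S (S ⧸ Ideal.span {q})).colon
      {Ideal.Quotient.mk (Ideal.span {q}) z} ↔ q ∣ r * z := by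
    intro z r
    rw [Submodule.mem_colon_singleton, Submodule.mem_bot, ← Ideal.mem_span_singleton,
      ← Ideal.Quotient.eq_zero_iff_mem, map_mul]
    rfl
  have hmem : ∀ r, r ∈ P ↔ q ∣ r * p' := fun r => by rw [hy, hcol]
  have hqP : q ∈ P := (hmem q).2 (dvd_mul_right _ _)
  refine ⟨P, hPp, le_antisymm ?_ ?_, fun r hr => hle ((hcol p r).2 hr)⟩
  · obtain ⟨u, hu, v, hv, huv⟩ : ∃ u ∈ P, ∃ v ∉ P, u * p' = q * v := by
      by_contra! H
      have hstab : ∀ u ∈ P, ∃ v ∈ P, u * p' = q * v := by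
        intro u hu
        obtain ⟨v, hv⟩ := (hmem u).1 hu
        exact ⟨v, by_contra fun h => H u hu v h hv, hv⟩
      let K := FractionRing S
      have hq' : algebraMap S K q ≠ 0 := by simpa using hq
      have hint : IsIntegral S (algebraMap S K p' / algebraMap S K q) := by
        refine isIntegral_of_smul_mem_submodule (IsLocalization.coeSubmodule K P) ?_ ?_ _ ?_
        · intro h
          have : algebraMap S K q ∈ IsLocalization.coeSubmodule K P :=
            (IsLocalization.mem_coeSubmodule _ _).2 ⟨q, hqP, rfl⟩
          rw [h] at this
          exact hq' (by simpa using this)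
        · exact (IsNoetherian.noetherian P).map _
        · intro n hn
          obtain ⟨u, hu, rfl⟩ := (IsLocalization.mem_coeSubmodule _ _).1 hn
          obtain ⟨v, hv, huv⟩ := hstab u hu
          refine (IsLocalization.mem_coeSubmodule _ _).2 ⟨v, hv, ?_⟩
          rw [smul_eq_mul, div_mul_eq_mul_div, eq_div_iff hq', ← map_mul, ← map_mul,
            mul_comm v, ← huv, mul_comm]
      obtain ⟨s, hs⟩ := IsIntegrallyClosed.isIntegral_iff.1 hint
      rw [eq_div_iff hq', ← map_mul] at hs
      have hs' := IsFractionRing.injective S K hs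
      refine hPp.ne_top ((Ideal.eq_top_iff_one _).2 ((hmem 1).2 ⟨s, ?_⟩))
      rw [one_mul, ← hs', mul_comm]
    -- `P` is minimal over `u`: for `w ∈ P` the product `vw` is a multiple of `u`, while `v ∉ P`.
    -- Krull's principal ideal theorem then bounds the height.
    refine Ideal.height_le_one_of_isPrincipal_of_mem_minimalPrimes (Ideal.span {u}) P
      ⟨⟨hPp, (Ideal.span_singleton_le_iff_mem _).2 hu⟩, ?_⟩
    rintro Q' ⟨hQ', huQ⟩ hQP w hw
    obtain ⟨t, ht⟩ := (hmem w).1 hw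
    have hvw : v * w = u * t := by
      refine mul_left_cancel₀ hq ?_
      rw [← mul_assoc, ← huv, mul_assoc, mul_comm p', ht]; ring
    have huQ' : u ∈ Q' := huQ (Ideal.mem_span_singleton_self u)
    have : v * w ∈ Q' := hvw ▸ Q'.mul_mem_right t huQ'
    exact (hQ'.mem_or_mem this).resolve_left fun h => hv (hQP h)
  · rw [Order.one_le_iff_ne_zero, Ne, Ideal.height_eq_zero_iff_eq_bot]
    rintro rfl
    exact hq (by simpa using hqP)

/-! ### Orders generated by two quadratic elements, and descent modulo `2`. -/

section Quadratic

variable {S K : Type*} [CommRing S] [Field K] [Algebra S K]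

/-- Membership in the order generated by two quadratic integers. -/
theorem mem_adjoin_pair_iff {α β : K} {s t u v : S}
    (hα : α ^ 2 = algebraMap S K s + algebraMap S K t * α)
    (hβ : β ^ 2 = algebraMap S K u + algebraMap S K v * β) (x : K) :
    x ∈ Algebra.adjoin S ({α, β} : Set K) ↔ ∃ c₀ c₁ c₂ c₃ : S,
      x = algebraMap S K c₀ + algebraMap S K c₁ * α + algebraMap S K c₂ * β +
        algebraMap S K c₃ * (α * β) := by
  constructor
  · intro hx
    induction hx using Algebra.adjoin_induction with
    | mem x hx =>
      rcases hx with rfl | rfl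
      · exact ⟨0, 1, 0, 0, by simp⟩
      · exact ⟨0, 0, 1, 0, by simp⟩
    | algebraMap r => exact ⟨r, 0, 0, 0, by simp⟩
    | add x y _ _ hx hy =>
      obtain ⟨c₀, c₁, c₂, c₃, rfl⟩ := hx
      obtain ⟨d₀, d₁, d₂, d₃, rfl⟩ := hy
      exact ⟨c₀ + d₀, c₁ + d₁, c₂ + d₂, c₃ + d₃, by simp only [map_add]; ring⟩
    | mul x y _ _ hx hy =>
      obtain ⟨c₀, c₁, c₂, c₃, rfl⟩ := hx
      obtain ⟨d₀, d₁, d₂, d₃, rfl⟩ := hy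
      refine ⟨c₀ * d₀ + c₁ * d₁ * s + c₂ * d₂ * u + c₃ * d₃ * s * u,
        c₀ * d₁ + c₁ * d₀ + c₁ * d₁ * t + (c₂ * d₃ + c₃ * d₂) * u + c₃ * d₃ * t * u,
        c₀ * d₂ + c₂ * d₀ + c₂ * d₂ * v + (c₁ * d₃ + c₃ * d₁) * s + c₃ * d₃ * s * v,
        c₀ * d₃ + c₃ * d₀ + c₁ * d₂ + c₂ * d₁ + (c₁ * d₃ + c₃ * d₁) * t
          + (c₂ * d₃ + c₃ * d₂) * v + c₃ * d₃ * t * v, ?_⟩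
      simp only [map_add, map_mul]
      generalize algebraMap S K c₀ = c₀, algebraMap S K c₁ = c₁, algebraMap S K c₂ = c₂,
        algebraMap S K c₃ = c₃, algebraMap S K d₀ = d₀, algebraMap S K d₁ = d₁,
        algebraMap S K d₂ = d₂, algebraMap S K d₃ = d₃ at *
      generalize algebraMap S K s = s, algebraMap S K t = t, algebraMap S K u = u,
        algebraMap S K v = v at *
      linear_combination (c₁ * d₁ + (c₁ * d₃ + c₃ * d₁) * β + c₃ * d₃ * β ^ 2) * hα
        + (c₂ * d₂ + (c₂ * d₃ + c₃ * d₂) * α + c₃ * d₃ * (s + t * α)) * hβ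
  · rintro ⟨c₀, c₁, c₂, c₃, rfl⟩
    have h₁ : α ∈ Algebra.adjoin S ({α, β} : Set K) := Algebra.subset_adjoin (by simp)
    have h₂ : β ∈ Algebra.adjoin S ({α, β} : Set K) := Algebra.subset_adjoin (by simp)
    have h := Subalgebra.algebraMap_mem (Algebra.adjoin S ({α, β} : Set K))
    exact add_mem (add_mem (add_mem (h _) (mul_mem (h _) h₁)) (mul_mem (h _) h₂))
      (mul_mem (h _) (mul_mem h₁ h₂))

/-- The elements `1, α, β, αβ` are linearly independent over `S`. -/
def IndepQuad (S : Type*) {K : Type*} [CommRing S] [CommRing K] [Algebra S K] (α β : K) : Prop :=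
  ∀ c₀ c₁ c₂ c₃ : S, algebraMap S K c₀ + algebraMap S K c₁ * α + algebraMap S K c₂ * β +
    algebraMap S K c₃ * (α * β) = 0 → c₀ = 0 ∧ c₁ = 0 ∧ c₂ = 0 ∧ c₃ = 0

theorem IndepQuad.eq {α β : K} (h : IndepQuad S α β) {c₀ c₁ c₂ c₃ d₀ d₁ d₂ d₃ : S}
    (e : algebraMap S K c₀ + algebraMap S K c₁ * α + algebraMap S K c₂ * β +
      algebraMap S K c₃ * (α * β) = algebraMap S K d₀ + algebraMap S K d₁ * α +
      algebraMap S K d₂ * β + algebraMap S K d₃ * (α * β)) :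
    c₀ = d₀ ∧ c₁ = d₁ ∧ c₂ = d₂ ∧ c₃ = d₃ := by
  have := h (c₀ - d₀) (c₁ - d₁) (c₂ - d₂) (c₃ - d₃)
    (by simp only [map_sub]; linear_combination e)
  simpa [sub_eq_zero] using this

/-- Two relations between squares modulo `2` force both unknowns to be even. -/
theorem two_dvd_of_relations (h2 : Prime (2 : S)) {a b h₁ h₂ c d : S}
    (ha : ¬ 2 ∣ a) (hb : ¬ 2 ∣ b) (hab : ¬ 2 ∣ a * h₂ ^ 2 + b * h₁ ^ 2)
    (e₁ : 2 ∣ c ^ 2 * a + d ^ 2 * b)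
    (e₂ : 2 ∣ c ^ 4 * h₁ ^ 2 * a + d ^ 4 * h₂ ^ 2 * b) : 2 ∣ c ∧ 2 ∣ d := by
  -- Eliminating `d²b` between the two relations leaves a product divisible by the prime `2`.
  have key : 2 ∣ c ^ 2 * h₁ ^ 2 - d ^ 2 * h₂ ^ 2 ∨ 2 ∣ c ^ 2 * a := by
    refine h2.dvd_or_dvd ?_
    have : (c ^ 2 * h₁ ^ 2 - d ^ 2 * h₂ ^ 2) * (c ^ 2 * a) =
        (c ^ 4 * h₁ ^ 2 * a + d ^ 4 * h₂ ^ 2 * b) - d ^ 2 * h₂ ^ 2 * (c ^ 2 * a + d ^ 2 * b) := by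
      ring
    rw [this]
    exact dvd_sub e₂ (e₁.mul_left _)
  have hc : 2 ∣ c := by
    rcases key with h | h
    · have : 2 ∣ c ^ 2 * (a * h₂ ^ 2 + b * h₁ ^ 2) := by
        have : c ^ 2 * (a * h₂ ^ 2 + b * h₁ ^ 2) = h₂ ^ 2 * (c ^ 2 * a + d ^ 2 * b)
            + b * (c ^ 2 * h₁ ^ 2 - d ^ 2 * h₂ ^ 2) := by ring
        rw [this]
        exact dvd_add (e₁.mul_left _) (h.mul_left _)
      exact h2.dvd_of_dvd_pow ((h2.dvd_or_dvd this).resolve_right hab)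
    · exact h2.dvd_of_dvd_pow ((h2.dvd_or_dvd h).resolve_right ha)
  refine ⟨hc, ?_⟩
  have : 2 ∣ d ^ 2 * b := (dvd_add_right (((dvd_pow hc two_ne_zero)).mul_right a)).1 e₁
  exact h2.dvd_of_dvd_pow ((h2.dvd_or_dvd this).resolve_right hb)

/-- If twice every integral element lies in the order spanned by `1, α, β, αβ`, then the integral
elements are exactly those in the span of `1, α, β, αβ/2`. -/
theorem exists_coords_of_isIntegral [IsDomain S] (h2 : Prime (2 : S)) (h2K : (2 : K) ≠ 0)
    {α β : K} {a b h₁ h₂ : S}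
    (hα : α ^ 2 = 2 * (algebraMap S K a - algebraMap S K h₁ * α))
    (hβ : β ^ 2 = 2 * (algebraMap S K b - algebraMap S K h₂ * β))
    (hind : IndepQuad S α β)
    (ha : ¬ 2 ∣ a) (hb : ¬ 2 ∣ b) (hab : ¬ 2 ∣ a * h₂ ^ 2 + b * h₁ ^ 2)
    (hτ : IsIntegral S (α * β / 2))
    (hA : ∀ x : K, IsIntegral S x → 2 * x ∈ Algebra.adjoin S ({α, β} : Set K))
    (x : K) (hx : IsIntegral S x) : ∃ c₀ c₁ c₂ c₃ : S,
      x = algebraMap S K c₀ + algebraMap S K c₁ * α + algebraMap S K c₂ * β +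
        algebraMap S K c₃ * (α * β / 2) := by
  have h2S : algebraMap S K 2 = 2 := map_ofNat _ 2
  have hA' : ∀ x : K, IsIntegral S x → ∃ c₀ c₁ c₂ c₃ : S,
      2 * x = algebraMap S K c₀ + algebraMap S K c₁ * α + algebraMap S K c₂ * β +
        algebraMap S K c₃ * (α * β) := by
    intro x hx
    refine (mem_adjoin_pair_iff (s := 2 * a) (t := -2 * h₁) (u := 2 * b) (v := -2 * h₂)
      ?_ ?_ _).1 (hA x hx)
    · simp only [map_mul, map_neg, h2S]; linear_combination hα
    · simp only [map_mul, map_neg, h2S]; linear_combination hβ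
  have hmap : ∀ s : S, IsIntegral S (algebraMap S K s) := fun s => isIntegral_algebraMap
  have hsub : ∀ u v w : K, IsIntegral S u → IsIntegral S v → w = u - v → IsIntegral S w :=
    fun u v w hu hv hw => hw ▸ hu.sub hv
  -- the constant coefficient of twice an integral combination is even
  have hconst : ∀ c₀ c₁ c₂ : S, IsIntegral S ((algebraMap S K c₀ + algebraMap S K c₁ * α +
      algebraMap S K c₂ * β) / 2) → 2 ∣ c₀ := by
    intro c₀ c₁ c₂ h
    obtain ⟨d₀, d₁, d₂, d₃, hd⟩ := hA' _ (h.pow 2)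
    -- Four times the square of the given element is twice an element of the order, so its
    -- coordinates are even. Its constant coordinate is `c₀²` plus an even term.
    have := hind.eq (c₀ := c₀ ^ 2 + 2 * (c₁ ^ 2 * a + c₂ ^ 2 * b))
      (c₁ := 2 * (c₀ * c₁ - c₁ ^ 2 * h₁)) (c₂ := 2 * (c₀ * c₂ - c₂ ^ 2 * h₂)) (c₃ := 2 * c₁ * c₂)
      (d₀ := 2 * d₀) (d₁ := 2 * d₁) (d₂ := 2 * d₂) (d₃ := 2 * d₃) (by
        simp only [map_add, map_sub, map_mul, map_pow, h2S]
        field_simp at hd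
        linear_combination hd - algebraMap S K c₁ ^ 2 * hα - algebraMap S K c₂ ^ 2 * hβ)
    refine h2.dvd_of_dvd_pow (n := 2) ?_
    exact (dvd_add_left (dvd_mul_right 2 _)).1 (Dvd.intro _ this.1.symm)
  -- Square and subtract `cd · αβ/2`. What remains is half of a linear form whose constant term must
  -- be even. Removing that term leaves an element of the original shape with `(c²h₁, d²h₂)` in
  -- place of `(c, d)`, so the step can be repeated.
  have hrel : ∀ c d : S, IsIntegral S ((algebraMap S K c * α + algebraMap S K d * β) / 2) →
      2 ∣ c ^ 2 * a + d ^ 2 * b ∧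
      IsIntegral S ((algebraMap S K (c ^ 2 * h₁) * α + algebraMap S K (d ^ 2 * h₂) * β) / 2) := by
    intro c d h
    have h' : IsIntegral S ((algebraMap S K (c ^ 2 * a + d ^ 2 * b)
        + algebraMap S K (-(c ^ 2 * h₁)) * α + algebraMap S K (-(d ^ 2 * h₂)) * β) / 2) := by
      refine hsub _ _ _ (h.pow 2) ((hmap (c * d)).mul hτ) ?_
      simp only [map_add, map_neg, map_mul, map_pow]
      field_simp
      linear_combination (-1) * algebraMap S K c ^ 2 * hα - algebraMap S K d ^ 2 * hβ
    have hdvd := hconst _ _ _ h'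
    refine ⟨hdvd, ?_⟩
    obtain ⟨e, he⟩ := hdvd
    refine hsub _ _ _ (hmap e) h' ?_
    rw [he]
    simp only [map_neg, map_mul, h2S]
    field_simp
    ring
  obtain ⟨c₀, c₁, c₂, c₃, hc⟩ := hA' x hx
  have h₀ : IsIntegral S ((algebraMap S K c₀ + algebraMap S K c₁ * α +
      algebraMap S K c₂ * β) / 2) := by
    refine hsub _ _ _ hx ((hmap c₃).mul hτ) ?_
    field_simp
    linear_combination -hc
  obtain ⟨e₀, rfl⟩ := hconst _ _ _ h₀
  have h₁' : IsIntegral S ((algebraMap S K c₁ * α + algebraMap S K c₂ * β) / 2) := by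
    refine hsub _ _ _ h₀ (hmap e₀) ?_
    simp only [map_mul, h2S]
    field_simp
    ring
  -- Two rounds give the two congruences that `two_dvd_of_relations` needs.
  obtain ⟨r₁, h₂'⟩ := hrel _ _ h₁'
  obtain ⟨r₂, -⟩ := hrel _ _ h₂'
  obtain ⟨⟨e₁, rfl⟩, ⟨e₂, rfl⟩⟩ := two_dvd_of_relations h2 ha hb hab r₁ (by convert r₂ using 1; ring)
  refine ⟨e₀, e₁, e₂, c₃, ?_⟩
  simp only [map_mul, h2S] at hc
  field_simp
  linear_combination hc

end Quadratic


/-! ### Coordinates of integral elements over `L`, and the inclusion `2R ⊆ A`. -/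

section Coordinates

variable {S L K : Type*} [CommRing S] [Field L] [Algebra S L] [Field K] [Algebra S K]
  [Algebra L K] [IsScalarTower S L K]

/-- An integrally closed subalgebra of a field contains every integral fraction of its elements. -/
theorem mem_of_isIntegral_of_mul_mem (T : Subalgebra S K) [IsIntegrallyClosed T] {x q : K}
    (hx : IsIntegral S x) (hq : q ∈ T) (hq0 : q ≠ 0) (hxq : x * q ∈ T) : x ∈ T := by
  let F := FractionRing T
  have hinj : Function.Injective (algebraMap T K) := Subtype.val_injective
  have hxT : IsIntegral T x := hx.tower_top
  let ψ : F →ₐ[T] K := IsFractionRing.liftAlgHom (g := Algebra.ofId T K) hinj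
  have hψ : Function.Injective ψ := ψ.toRingHom.injective
  have hqF : (algebraMap T F ⟨q, hq⟩) ≠ 0 := by
    rw [Ne, FaithfulSMul.algebraMap_eq_zero_iff]
    exact fun h => hq0 (congrArg Subtype.val h)
  have hy : ψ (algebraMap T F ⟨x * q, hxq⟩ / algebraMap T F ⟨q, hq⟩) = x := by
    rw [map_div₀, ψ.commutes, ψ.commutes]
    exact mul_div_cancel_right₀ x hq0
  rw [← hy, isIntegral_algHom_iff ψ hψ] at hxT
  obtain ⟨t, ht⟩ := IsIntegrallyClosed.isIntegral_iff.1 hxT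
  rw [← hy, ← ht, ψ.commutes]
  exact t.2

/-- Elements of `S[ω]` with `ω ^ 2 ∈ S` are linear polynomials in `ω`. -/
theorem exists_of_mem_adjoin_sqrt {ω : K} {f : S} (hω : ω ^ 2 = algebraMap S K f) {x : K}
    (hx : x ∈ Algebra.adjoin S ({ω} : Set K)) :
    ∃ s t : S, x = algebraMap S K s + algebraMap S K t * ω := by
  induction hx using Algebra.adjoin_induction with
  | mem x hx =>
    rw [Set.mem_singleton_iff] at hx
    exact ⟨0, 1, by simp [hx]⟩
  | algebraMap r => exact ⟨r, 0, by simp⟩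
  | add x y _ _ hx hy =>
    obtain ⟨s, t, rfl⟩ := hx
    obtain ⟨u, v, rfl⟩ := hy
    exact ⟨s + u, t + v, by simp only [map_add]; ring⟩
  | mul x y _ _ hx hy =>
    obtain ⟨s, t, rfl⟩ := hx
    obtain ⟨u, v, rfl⟩ := hy
    refine ⟨s * u + t * v * f, s * v + t * u, ?_⟩
    simp only [map_add, map_mul]
    linear_combination algebraMap S K t * algebraMap S K v * hω

/-- If `S[ω]` is integrally closed, integral elements of `L(ω)` have coordinates in `S`. -/
theorem exists_coords_of_isIntegral_sqrt [IsDomain S] [IsFractionRing S L] {ω : K} {f : S}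
    (hω : ω ^ 2 = algebraMap S K f)
    (hind : ∀ c d : L, algebraMap L K c + algebraMap L K d * ω = 0 → c = 0 ∧ d = 0)
    (hcl : IsIntegrallyClosed (Algebra.adjoin S ({ω} : Set K))) {d₀ d₁ : L}
    (hx : IsIntegral S (algebraMap L K d₀ + algebraMap L K d₁ * ω)) :
    ∃ s₀ s₁ : S, d₀ = algebraMap S L s₀ ∧ d₁ = algebraMap S L s₁ := by
  have hST : ∀ s : S, algebraMap S K s = algebraMap L K (algebraMap S L s) :=
    IsScalarTower.algebraMap_apply S L K
  have hmem : algebraMap L K d₀ + algebraMap L K d₁ * ω ∈ Algebra.adjoin S ({ω} : Set K) := by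
    obtain ⟨n₀, q₀, hq₀, rfl⟩ := IsFractionRing.div_surjective (A := S) d₀
    obtain ⟨n₁, q₁, hq₁, rfl⟩ := IsFractionRing.div_surjective (A := S) d₁
    have h₀ : algebraMap S L q₀ ≠ 0 := by simpa using nonZeroDivisors.ne_zero hq₀
    have h₁ : algebraMap S L q₁ ≠ 0 := by simpa using nonZeroDivisors.ne_zero hq₁
    have h₀' : algebraMap S K q₀ ≠ 0 := by rw [hST]; simpa using h₀
    have h₁' : algebraMap S K q₁ ≠ 0 := by rw [hST]; simpa using h₁
    refine mem_of_isIntegral_of_mul_mem _ hx (q := algebraMap S K (q₀ * q₁))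
      (Subalgebra.algebraMap_mem _ _) (by rw [map_mul]; exact mul_ne_zero h₀' h₁') ?_
    have : (algebraMap L K (algebraMap S L n₀ / algebraMap S L q₀) +
        algebraMap L K (algebraMap S L n₁ / algebraMap S L q₁) * ω) * algebraMap S K (q₀ * q₁) =
        algebraMap S K (n₀ * q₁) + algebraMap S K (n₁ * q₀) * ω := by
      simp only [map_div₀, map_mul, ← hST]
      field_simp
    rw [this]
    exact add_mem (Subalgebra.algebraMap_mem _ _)
      (mul_mem (Subalgebra.algebraMap_mem _ _) (Algebra.subset_adjoin rfl))
  obtain ⟨s, t, hst⟩ := exists_of_mem_adjoin_sqrt hω hmem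
  obtain ⟨e₀, e₁⟩ := hind (d₀ - algebraMap S L s) (d₁ - algebraMap S L t) (by
    simp only [map_sub, ← hST]; linear_combination hst)
  exact ⟨s, t, sub_eq_zero.1 e₀, sub_eq_zero.1 e₁⟩

theorem IndepQuad.symm {ω μ : K} (h : IndepQuad L ω μ) : IndepQuad L μ ω := by
  intro c₀ c₁ c₂ c₃ e
  obtain ⟨h₀, h₁, h₂, h₃⟩ := h c₀ c₂ c₁ c₃ (by linear_combination e)
  exact ⟨h₀, h₂, h₁, h₃⟩

/-- The conjugation `μ ↦ -μ` preserves integrality. -/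
theorem IndepQuad.isIntegral_conj {ω μ : K} {f g : S} (h : IndepQuad L ω μ)
    (hω : ω ^ 2 = algebraMap S K f) (hμ : μ ^ 2 = algebraMap S K g) {d₀ d₁ d₂ d₃ : L}
    (hx : IsIntegral S (algebraMap L K d₀ + algebraMap L K d₁ * ω + algebraMap L K d₂ * μ +
      algebraMap L K d₃ * (ω * μ))) :
    IsIntegral S (algebraMap L K d₀ + algebraMap L K d₁ * ω - algebraMap L K d₂ * μ -
      algebraMap L K d₃ * (ω * μ)) := by
  set x := algebraMap L K d₀ + algebraMap L K d₁ * ω + algebraMap L K d₂ * μ +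
      algebraMap L K d₃ * (ω * μ) with hxd
  set y := algebraMap L K d₀ + algebraMap L K d₁ * ω - algebraMap L K d₂ * μ -
      algebraMap L K d₃ * (ω * μ) with hyd
  rw [IsScalarTower.algebraMap_apply S L K] at hω hμ
  set F := algebraMap S L f
  set G := algebraMap S L g
  -- In place of a field automorphism: any polynomial over `S` takes conjugate values at `x` and
  -- `y`. If it vanishes at `x`, independence kills all four coordinates, so it vanishes at `y` too.
  have key : ∀ p : S[X], ∃ u₀ u₁ u₂ u₃ : L,
      Polynomial.aeval x p = algebraMap L K u₀ + algebraMap L K u₁ * ω + algebraMap L K u₂ * μ +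
        algebraMap L K u₃ * (ω * μ) ∧
      Polynomial.aeval y p = algebraMap L K u₀ + algebraMap L K u₁ * ω - algebraMap L K u₂ * μ -
        algebraMap L K u₃ * (ω * μ) := by
    intro p
    induction p using Polynomial.induction_on with
    | C r =>
      refine ⟨algebraMap S L r, 0, 0, 0, ?_, ?_⟩ <;>
        simp [IsScalarTower.algebraMap_apply S L K]
    | add p q hp hq =>
      obtain ⟨u₀, u₁, u₂, u₃, e, e'⟩ := hp
      obtain ⟨v₀, v₁, v₂, v₃, k, k'⟩ := hq
      refine ⟨u₀ + v₀, u₁ + v₁, u₂ + v₂, u₃ + v₃, ?_, ?_⟩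
      · simp only [map_add]; linear_combination e + k
      · simp only [map_add]; linear_combination e' + k'
    | monomial n r hp =>
      obtain ⟨u₀, u₁, u₂, u₃, e, e'⟩ := hp
      refine ⟨u₀ * d₀ + u₁ * d₁ * F + u₂ * d₂ * G + u₃ * d₃ * F * G,
        u₀ * d₁ + u₁ * d₀ + (u₂ * d₃ + u₃ * d₂) * G,
        u₀ * d₂ + u₂ * d₀ + (u₁ * d₃ + u₃ * d₁) * F,
        u₀ * d₃ + u₃ * d₀ + u₁ * d₂ + u₂ * d₁, ?_, ?_⟩
      · rw [pow_succ, ← mul_assoc, map_mul, e, Polynomial.aeval_X, hxd]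
        simp only [map_add, map_mul, ← hω, ← hμ]
        ring
      · rw [pow_succ, ← mul_assoc, map_mul, e', Polynomial.aeval_X, hyd]
        simp only [map_add, map_mul, ← hω, ← hμ]
        ring
  obtain ⟨p, hp, hpx⟩ := hx
  obtain ⟨u₀, u₁, u₂, u₃, e, e'⟩ := key p
  rw [← Polynomial.aeval_def, e] at hpx
  obtain ⟨rfl, rfl, rfl, rfl⟩ := h _ _ _ _ hpx
  exact ⟨p, hp, by rw [← Polynomial.aeval_def, e']; simp⟩

/-- The elements `1, ω, μ, ωμ` are independent over `L`. -/
theorem indepQuad_of_irreducible [IsFractionRing S L] [IsIntegrallyClosed S] {ω μ : K} {f g : S}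
    (hω : ω ^ 2 = algebraMap S K f) (hμ : μ ^ 2 = algebraMap S K g)
    (hf : ¬ ∃ x : S, x ^ 2 = f)
    (hirr : Irreducible (Polynomial.X ^ 2 - Polynomial.C (algebraMap S L⟮ω⟯ g) : L⟮ω⟯[X])) :
    IndepQuad L ω μ := by
  have hST : ∀ s : S, algebraMap S K s = algebraMap L K (algebraMap S L s) :=
    IsScalarTower.algebraMap_apply S L K
  have hωL : ∀ c : L, algebraMap L K c ≠ ω := by
    rintro c rfl
    have hc : c ^ 2 = algebraMap S L f :=
      (algebraMap L K).injective (by rw [map_pow, hω, hST])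
    -- A square root of `f` in `L` is integral over `S`, hence lies in `S`, where `f` has none.
    obtain ⟨s, rfl⟩ := IsIntegrallyClosed.isIntegral_iff.1
      (IsIntegral.of_pow two_pos (hc ▸ isIntegral_algebraMap (R := S)) : IsIntegral S c)
    exact hf ⟨s, IsFractionRing.injective S L (by rw [map_pow, hc])⟩
  have hpair : ∀ c d : L, algebraMap L K c + algebraMap L K d * ω = 0 → c = 0 ∧ d = 0 := by
    intro c d e
    have hd : d = 0 := by
      by_contra hd
      refine hωL (-c / d) ?_
      have : algebraMap L K d ≠ 0 := by simpa using hd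
      rw [map_div₀, map_neg]
      field_simp
      linear_combination -e
    subst hd
    exact ⟨by simpa using e, rfl⟩
  have hμω : μ ∉ L⟮ω⟯ := by
    intro hm
    have hdeg := Polynomial.degree_eq_one_of_irreducible_of_root hirr (x := ⟨μ, hm⟩) (by
      rw [Polynomial.IsRoot.def, Polynomial.eval_sub, Polynomial.eval_pow, Polynomial.eval_X,
        Polynomial.eval_C, sub_eq_zero]
      exact Subtype.ext hμ)
    rw [Polynomial.degree_X_pow_sub_C two_pos] at hdeg
    exact absurd hdeg (by decide)
  intro c₀ c₁ c₂ c₃ e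
  have hL : ∀ c d : L, algebraMap L K c + algebraMap L K d * ω ∈ L⟮ω⟯ := fun c d =>
    add_mem (L⟮ω⟯.algebraMap_mem c)
      (mul_mem (L⟮ω⟯.algebraMap_mem d) (IntermediateField.mem_adjoin_simple_self L ω))
  have h0 : algebraMap L K c₂ + algebraMap L K c₃ * ω = 0 := by
    by_contra h0
    refine hμω ?_
    have : μ = -(algebraMap L K c₀ + algebraMap L K c₁ * ω) /
        (algebraMap L K c₂ + algebraMap L K c₃ * ω) := by
      rw [eq_div_iff h0]; linear_combination e
    rw [this]
    exact div_mem (neg_mem (hL _ _)) (hL _ _)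
  obtain ⟨rfl, rfl⟩ := hpair _ _ h0
  obtain ⟨rfl, rfl⟩ := hpair c₀ c₁ (by simpa using e)
  exact ⟨rfl, rfl, rfl, rfl⟩

variable [IsDomain S] [IsFractionRing S L]

/-- Twice the `L(ω)`-component of an integral element lies in `S[ω]`. -/
theorem IndepQuad.two_mul_coords {ω μ : K} {f g : S} (h : IndepQuad L ω μ)
    (hω : ω ^ 2 = algebraMap S K f) (hμ : μ ^ 2 = algebraMap S K g)
    (hcl : IsIntegrallyClosed (Algebra.adjoin S ({ω} : Set K))) {d₀ d₁ d₂ d₃ : L}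
    (hx : IsIntegral S (algebraMap L K d₀ + algebraMap L K d₁ * ω + algebraMap L K d₂ * μ +
      algebraMap L K d₃ * (ω * μ))) :
    ∃ s₀ s₁ : S, 2 * d₀ = algebraMap S L s₀ ∧ 2 * d₁ = algebraMap S L s₁ := by
  -- The sum with the conjugate is the trace to `L(ω)`, namely `2d₀ + 2d₁ω`.
  have hy := hx.add (h.isIntegral_conj hω hμ hx)
  refine exists_coords_of_isIntegral_sqrt hω (fun c d e => ?_) hcl (d₀ := 2 * d₀) (d₁ := 2 * d₁) ?_
  · obtain ⟨h₀, h₁, -, -⟩ := h c d 0 0 (by simpa using e)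
    exact ⟨h₀, h₁⟩
  · rw [show algebraMap L K (2 * d₀) + algebraMap L K (2 * d₁) * ω =
      _ + (algebraMap L K d₀ + algebraMap L K d₁ * ω - algebraMap L K d₂ * μ -
      algebraMap L K d₃ * (ω * μ)) from ?_]
    · exact hy
    · simp only [map_mul, map_ofNat]; ring

/-- Twice an integral element of `L(ω, μ)` lies in `S[ω, μ]`. -/
theorem IndepQuad.two_mul_mem_adjoin [IsNoetherianRing S] [IsIntegrallyClosed S]
    {ω μ : K} {f g : S} (h : IndepQuad L ω μ)
    (hspan : ∀ x : K, ∃ d₀ d₁ d₂ d₃ : L, x = algebraMap L K d₀ + algebraMap L K d₁ * ω +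
      algebraMap L K d₂ * μ + algebraMap L K d₃ * (ω * μ))
    (hω : ω ^ 2 = algebraMap S K f) (hμ : μ ^ 2 = algebraMap S K g)
    (hclω : IsIntegrallyClosed (Algebra.adjoin S ({ω} : Set K)))
    (hclμ : IsIntegrallyClosed (Algebra.adjoin S ({μ} : Set K)))
    (hfg : ¬ ∃ Q : Ideal S, Q.IsPrime ∧ Q.height = 1 ∧ f ∈ Q ∧ g ∈ Q)
    {x : K} (hx : IsIntegral S x) : 2 * x ∈ Algebra.adjoin S ({ω, μ} : Set K) := by
  have hST : ∀ s : S, algebraMap S K s = algebraMap L K (algebraMap S L s) :=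
    IsScalarTower.algebraMap_apply S L K
  have hsqrt : ∀ {θ : K} {e : S}, θ ^ 2 = algebraMap S K e → IsIntegral S θ := fun hθ =>
    IsIntegral.of_pow two_pos (hθ ▸ isIntegral_algebraMap)
  have hcongr : ∀ u v : K, IsIntegral S u → v = u → IsIntegral S v := fun u v hu e => e ▸ hu
  obtain ⟨d₀, d₁, d₂, d₃, rfl⟩ := hspan x
  obtain ⟨s₀, s₁, e₀, e₁⟩ := h.two_mul_coords hω hμ hclω hx
  obtain ⟨-, s₂, -, e₂⟩ := h.symm.two_mul_coords hμ hω hclμ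
    (d₀ := d₀) (d₁ := d₂) (d₂ := d₁) (d₃ := d₃) (hcongr _ _ hx (by ring))
  obtain ⟨-, s, -, es⟩ := h.two_mul_coords hω hμ hclω
    -- Multiplying by `μ` turns `d₃ωμ` into `d₃gω`, so the trace to `L(ω)` now sees `d₃`.
    -- Multiplying by `ω` does the same below over `L(μ)`. Thus `2d₃g` and `2d₃f` both lie in `S`.
    (d₀ := d₂ * algebraMap S L g) (d₁ := d₃ * algebraMap S L g) (d₂ := d₀) (d₃ := d₁) (by
      refine hcongr _ _ (hx.mul (hsqrt hμ)) ?_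
      simp only [map_mul, ← hST, ← hμ]; ring)
  obtain ⟨-, t, -, et⟩ := h.symm.two_mul_coords hμ hω hclμ
    (d₀ := d₁ * algebraMap S L f) (d₁ := d₃ * algebraMap S L f) (d₂ := d₀) (d₃ := d₂) (by
      refine hcongr _ _ (hx.mul (hsqrt hω)) ?_
      simp only [map_mul, ← hST, ← hω]; ring)
  obtain ⟨s₃, e₃⟩ : ∃ s₃ : S, 2 * d₃ = algebraMap S L s₃ := by
    obtain ⟨p, q, hq, hpq⟩ := IsFractionRing.div_surjective (A := S) (2 * d₃)
    have hq0 : q ≠ 0 := nonZeroDivisors.ne_zero hq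
    have hqL : algebraMap S L q ≠ 0 := by simpa using hq0
    have hdvd : ∀ r u : S, 2 * (d₃ * algebraMap S L r) = algebraMap S L u → q ∣ r * p := by
      intro r u hru
      refine ⟨u, IsFractionRing.injective S L ?_⟩
      rw [map_mul, map_mul, ← hru, ← mul_assoc 2, ← hpq]
      field_simp
    by_cases hqp : q ∣ p
    · obtain ⟨c, rfl⟩ := hqp
      refine ⟨c, ?_⟩
      rw [← hpq, map_mul]
      field_simp
    -- If `2d₃ = p/q` were not in `S`, then `f` and `g` would both lie in the proper colon ideal `(q
    -- : p)`, hence in a common height one prime.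
    · obtain ⟨Q, hQ, hQ1, hQm⟩ := exists_height_one_of_not_dvd hq0 hqp
      exact (hfg ⟨Q, hQ, hQ1, hQm f (hdvd f t et), hQm g (hdvd g s es)⟩).elim
  refine (mem_adjoin_pair_iff (s := f) (t := 0) (u := g) (v := 0) (by simpa using hω)
    (by simpa using hμ) _).2 ⟨s₀, s₁, s₂, s₃, ?_⟩
  simp only [hST, ← e₀, ← e₁, ← e₂, ← e₃, map_mul, map_ofNat]
  ring

end Coordinates

/-- The elements `1, ω, μ, ωμ` span `L(ω, μ)` over `L`. -/
theorem exists_coords_of_adjoin_eq_top {L K : Type*} [Field L] [Field K] [Algebra L K]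
    {ω μ : K} {f g : L} (hω : ω ^ 2 = algebraMap L K f) (hμ : μ ^ 2 = algebraMap L K g)
    (hK : IntermediateField.adjoin L ({ω, μ} : Set K) = ⊤) (x : K) :
    ∃ d₀ d₁ d₂ d₃ : L, x = algebraMap L K d₀ + algebraMap L K d₁ * ω +
      algebraMap L K d₂ * μ + algebraMap L K d₃ * (ω * μ) := by
  have hsqrt : ∀ {θ : K} {e : L}, θ ^ 2 = algebraMap L K e → IsAlgebraic L θ := fun hθ =>
    (IsIntegral.of_pow two_pos (hθ ▸ isIntegral_algebraMap)).isAlgebraic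
  refine (mem_adjoin_pair_iff (s := f) (t := 0) (u := g) (v := 0) (by simpa using hω)
    (by simpa using hμ) x).1 ?_
  rw [← IntermediateField.adjoin_toSubalgebra_of_isAlgebraic, hK]
  · trivial
  · rintro y (rfl | rfl)
    exacts [hsqrt hω, hsqrt hμ]


/-! ### The prime of `S[α, β]` over `2`. -/

section Order

variable {S K : Type*} [CommRing S] [Field K] [Algebra S K]

/-- The ideal of those elements of `S[α, β]` whose constant coordinate is even. -/
def evenIdeal (α β : K) {s t u v : S}
    (hα : α ^ 2 = algebraMap S K (2 * s) + algebraMap S K t * α)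
    (hβ : β ^ 2 = algebraMap S K (2 * u) + algebraMap S K v * β) :
    Ideal (Algebra.adjoin S ({α, β} : Set K)) where
  carrier := {x | ∃ c₀ c₁ c₂ c₃ : S, (x : K) = algebraMap S K (2 * c₀) + algebraMap S K c₁ * α +
    algebraMap S K c₂ * β + algebraMap S K c₃ * (α * β)}
  add_mem' := by
    rintro x y ⟨c₀, c₁, c₂, c₃, hx⟩ ⟨d₀, d₁, d₂, d₃, hy⟩
    refine ⟨c₀ + d₀, c₁ + d₁, c₂ + d₂, c₃ + d₃, ?_⟩
    rw [Subalgebra.coe_add, hx, hy]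
    simp only [map_add, map_mul]
    ring
  zero_mem' := ⟨0, 0, 0, 0, by simp⟩
  smul_mem' := by
    rintro ⟨x, hx⟩ y ⟨d₀, d₁, d₂, d₃, hy⟩
    obtain ⟨c₀, c₁, c₂, c₃, rfl⟩ := (mem_adjoin_pair_iff hα hβ x).1 hx
    -- These are the coordinates of the product, the constant one being halved. That is possible
    -- because `α²` and `β²` have even constant terms.
    refine ⟨c₀ * d₀ + c₁ * d₁ * s + c₂ * d₂ * u + 2 * (c₃ * d₃ * s * u),
        c₀ * d₁ + c₁ * (2 * d₀) + c₁ * d₁ * t + (c₂ * d₃ + c₃ * d₂) * (2 * u)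
          + c₃ * d₃ * t * (2 * u),
        c₀ * d₂ + c₂ * (2 * d₀) + c₂ * d₂ * v + (c₁ * d₃ + c₃ * d₁) * (2 * s)
          + c₃ * d₃ * (2 * s) * v,
        c₀ * d₃ + c₃ * (2 * d₀) + c₁ * d₂ + c₂ * d₁ + (c₁ * d₃ + c₃ * d₁) * t
          + (c₂ * d₃ + c₃ * d₂) * v + c₃ * d₃ * t * v, ?_⟩
    rw [smul_eq_mul, Subalgebra.coe_mul, hy]
    simp only [map_add, map_mul] at hα hβ ⊢
    linear_combination (algebraMap S K c₁ * algebraMap S K d₁ +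
      (algebraMap S K c₁ * algebraMap S K d₃ + algebraMap S K c₃ * algebraMap S K d₁) * β +
      algebraMap S K c₃ * algebraMap S K d₃ * β ^ 2) * hα
      + (algebraMap S K c₂ * algebraMap S K d₂ +
      (algebraMap S K c₂ * algebraMap S K d₃ + algebraMap S K c₃ * algebraMap S K d₂) * α +
      algebraMap S K c₃ * algebraMap S K d₃ *
        (algebraMap S K 2 * algebraMap S K s + algebraMap S K t * α)) * hβ

variable {α β : K} {s t u v : S}
  {hα : α ^ 2 = algebraMap S K (2 * s) + algebraMap S K t * α}
  {hβ : β ^ 2 = algebraMap S K (2 * u) + algebraMap S K v * β}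

theorem coe_two_adjoin (T : Subalgebra S K) : ((2 : T) : K) = 2 := rfl

theorem two_mem_evenIdeal : 2 ∈ evenIdeal α β hα hβ :=
  ⟨1, 0, 0, 0, by simp [coe_two_adjoin, map_ofNat (algebraMap S K) 2]⟩

theorem left_mem_evenIdeal (h : α ∈ Algebra.adjoin S ({α, β} : Set K)) :
    ⟨α, h⟩ ∈ evenIdeal α β hα hβ :=
  ⟨0, 1, 0, 0, by simp⟩

theorem right_mem_evenIdeal (h : β ∈ Algebra.adjoin S ({α, β} : Set K)) :
    ⟨β, h⟩ ∈ evenIdeal α β hα hβ :=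
  ⟨0, 0, 1, 0, by simp⟩

/-- Reducing the constant coordinate modulo `2` identifies the quotient with `S/2S`, a domain
because `2` is prime. -/
theorem isPrime_evenIdeal (hind : IndepQuad S α β) (h2 : Prime (2 : S)) :
    (evenIdeal α β hα hβ).IsPrime := by
  have hc : ∀ (c : S) (h : algebraMap S K c ∈ Algebra.adjoin S ({α, β} : Set K)),
      ⟨algebraMap S K c, h⟩ ∈ evenIdeal α β hα hβ → 2 ∣ c := by
    rintro c h ⟨d₀, d₁, d₂, d₃, hd⟩
    exact ⟨d₀, (hind.eq (c₀ := c) (c₁ := 0) (c₂ := 0) (c₃ := 0) (by simpa using hd)).1⟩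
  -- every element is congruent to a constant
  have hred : ∀ x : Algebra.adjoin S ({α, β} : Set K), ∃ c : S,
      x - algebraMap S _ c ∈ evenIdeal α β hα hβ := by
    rintro ⟨x, hx⟩
    obtain ⟨c₀, c₁, c₂, c₃, rfl⟩ := (mem_adjoin_pair_iff hα hβ x).1 hx
    refine ⟨c₀, 0, c₁, c₂, c₃, ?_⟩
    rw [Subalgebra.coe_sub, Subalgebra.coe_algebraMap]
    simp only [mul_zero, map_zero]
    ring
  have heven : ∀ c : S, 2 ∣ c → algebraMap S _ c ∈ evenIdeal α β hα hβ := by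
    rintro _ ⟨c, rfl⟩
    exact ⟨c, 0, 0, 0, by simp⟩
  refine ⟨fun h => h2.not_isUnit (isUnit_of_dvd_one (hc 1 ?_ ?_)), ?_⟩
  · exact Subalgebra.algebraMap_mem _ _
  · rw [h]; trivial
  · intro x y hxy
    obtain ⟨c, hcx⟩ := hred x
    obtain ⟨d, hdy⟩ := hred y
    have hcd : 2 ∣ c * d := by
      refine hc _ (Subalgebra.algebraMap_mem _ _) ?_
      have : algebraMap S (Algebra.adjoin S ({α, β} : Set K)) (c * d) ∈ evenIdeal α β hα hβ := by
        have e : algebraMap S (Algebra.adjoin S ({α, β} : Set K)) (c * d) =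
            x * y - (y * (x - algebraMap S _ c) + algebraMap S _ c * (y - algebraMap S _ d)) := by
          rw [map_mul]; ring
        rw [e]
        exact sub_mem hxy (add_mem (Ideal.mul_mem_left _ _ hcx) (Ideal.mul_mem_left _ _ hdy))
      exact this
    refine (h2.dvd_or_dvd hcd).imp (fun h => ?_) (fun h => ?_)
    · simpa using add_mem hcx (heven _ h)
    · simpa using add_mem hdy (heven _ h)

end Order

/-! ### Uniqueness of the prime over `2`, its dual and the conductor. -/

section Main

variable {S K : Type*} [CommRing S] [Field K] [Algebra S K]
variable {α β : K} {a b h₁ h₂ : S}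
  {hα : α ^ 2 = algebraMap S K (2 * a) + algebraMap S K (-2 * h₁) * α}
  {hβ : β ^ 2 = algebraMap S K (2 * b) + algebraMap S K (-2 * h₂) * β}

/-- A prime of `S[α, β]` containing `2` contains `evenIdeal`. -/
theorem evenIdeal_le {Q : Ideal (Algebra.adjoin S ({α, β} : Set K))} (hQ : Q.IsPrime)
    (h2Q : 2 ∈ Q) : evenIdeal α β hα hβ ≤ Q := by
  have hmα : α ∈ Algebra.adjoin S ({α, β} : Set K) := Algebra.subset_adjoin (by simp)
  have hmβ : β ∈ Algebra.adjoin S ({α, β} : Set K) := Algebra.subset_adjoin (by simp)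
  have hα' : (⟨α, hmα⟩ : Algebra.adjoin S ({α, β} : Set K)) ∈ Q := by
    refine hQ.mem_of_pow_mem 2 ?_
    have : (⟨α, hmα⟩ : Algebra.adjoin S ({α, β} : Set K)) ^ 2 =
        (algebraMap S _ a - algebraMap S _ h₁ * ⟨α, hmα⟩) * 2 := by
      refine Subtype.ext ?_
      push_cast [coe_two_adjoin]
      simp only [map_mul, map_neg, map_ofNat] at hα
      linear_combination hα
    rw [this]
    exact Ideal.mul_mem_left _ _ h2Q
  have hβ' : (⟨β, hmβ⟩ : Algebra.adjoin S ({α, β} : Set K)) ∈ Q := by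
    refine hQ.mem_of_pow_mem 2 ?_
    have : (⟨β, hmβ⟩ : Algebra.adjoin S ({α, β} : Set K)) ^ 2 =
        (algebraMap S _ b - algebraMap S _ h₂ * ⟨β, hmβ⟩) * 2 := by
      refine Subtype.ext ?_
      push_cast [coe_two_adjoin]
      simp only [map_mul, map_neg, map_ofNat] at hβ
      linear_combination hβ
    rw [this]
    exact Ideal.mul_mem_left _ _ h2Q
  rintro x ⟨c₀, c₁, c₂, c₃, hx⟩
  have : x = algebraMap S _ c₀ * 2 + algebraMap S _ c₁ * ⟨α, hmα⟩ + algebraMap S _ c₂ * ⟨β, hmβ⟩ +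
      (algebraMap S _ c₃ * ⟨α, hmα⟩) * ⟨β, hmβ⟩ := by
    refine Subtype.ext ?_
    rw [hx]
    push_cast [coe_two_adjoin]
    simp only [map_ofNat]
    ring
  rw [this]
  exact add_mem (add_mem (add_mem (Ideal.mul_mem_left _ _ h2Q) (Ideal.mul_mem_left _ _ hα'))
    (Ideal.mul_mem_left _ _ hβ')) (Ideal.mul_mem_left _ _ hβ')

/-- Since every prime containing `2` contains this ideal, it is minimal over `(2)`, and Krull's
theorem applies. It is nonzero since it contains `2`. -/
theorem height_evenIdeal [IsNoetherianRing S] (hind : IndepQuad S α β) (h2 : Prime (2 : S))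
    (h2K : (2 : K) ≠ 0) : (evenIdeal α β hα hβ).height = 1 := by
  have hN : IsNoetherianRing (Algebra.adjoin S ({α, β} : Set K)) :=
    isNoetherianRing_of_fg (Subalgebra.fg_def.2 ⟨_, Set.toFinite _, rfl⟩)
  refine le_antisymm ?_ ?_
  · exact Ideal.height_le_one_of_isPrincipal_of_mem_minimalPrimes (Ideal.span {2}) _
      ⟨⟨isPrime_evenIdeal hind h2, (Ideal.span_singleton_le_iff_mem _).2 two_mem_evenIdeal⟩,
        fun Q hQ _ => evenIdeal_le hQ.1 (hQ.2 (Ideal.mem_span_singleton_self _))⟩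
  · rw [Order.one_le_iff_ne_zero, Ne, Ideal.height_eq_zero_iff_eq_bot]
    intro h
    have := two_mem_evenIdeal (hα := hα) (hβ := hβ)
    rw [h, Ideal.mem_bot] at this
    exact h2K (congrArg Subtype.val this)

/-- A strict inclusion between primes raises the height, so two nested primes of height one
coincide. -/
theorem eq_evenIdeal [IsNoetherianRing S] (hind : IndepQuad S α β) (h2 : Prime (2 : S))
    (h2K : (2 : K) ≠ 0) {Q : Ideal (Algebra.adjoin S ({α, β} : Set K))} (hQ : Q.IsPrime)
    (hQ1 : Q.height = 1) (h2Q : 2 ∈ Q) : Q = evenIdeal α β hα hβ := by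
  have hP := isPrime_evenIdeal (hα := hα) (hβ := hβ) hind h2
  have hP1 := height_evenIdeal (hα := hα) (hβ := hβ) hind h2 h2K
  by_contra hne
  have hlt := lt_of_le_of_ne (evenIdeal_le (hα := hα) (hβ := hβ) hQ h2Q) (Ne.symm hne)
  have := Ideal.height_add_one_le_of_lt_of_isPrime hlt
  rw [hP1, hQ1] at this
  exact absurd this (by decide)

/-- Multiplication by `αβ/2` maps `evenIdeal` into `S[α, β]`. -/
theorem half_mul_mem (h2K : (2 : K) ≠ 0) {p : Algebra.adjoin S ({α, β} : Set K)}
    (hp : p ∈ evenIdeal α β hα hβ) : α * β / 2 * (p : K) ∈ Algebra.adjoin S ({α, β} : Set K) := by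
  obtain ⟨d₀, d₁, d₂, d₃, hd⟩ := hp
  -- Expand using `α²/2 = a - h₁α` and `β²/2 = b - h₂β`. Only the constant coordinate needs its
  -- factor `2` to cancel the denominator.
  refine (mem_adjoin_pair_iff hα hβ _).2 ⟨2 * d₃ * a * b, d₂ * b - 2 * d₃ * b * h₁,
    d₁ * a - 2 * d₃ * a * h₂, d₀ - d₁ * h₁ - d₂ * h₂ + 2 * d₃ * h₁ * h₂, ?_⟩
  rw [hd]
  simp only [map_mul, map_neg, map_ofNat, map_sub, map_add] at hα hβ ⊢
  field_simp
  linear_combination (algebraMap S K d₁ * β + algebraMap S K d₃ * β ^ 2) * hα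
    + (algebraMap S K d₂ * α +
      algebraMap S K d₃ * (2 * algebraMap S K a - 2 * algebraMap S K h₁ * α)) * hβ

/-- The elements multiplying `evenIdeal` into `S[α, β]` are the combinations of
`1, α, β, αβ/2`. -/
theorem forall_mul_mem_iff (h2K : (2 : K) ≠ 0) (hind : IndepQuad S α β) (x : K) :
    (∀ p ∈ evenIdeal α β hα hβ, x * (p : K) ∈ Algebra.adjoin S ({α, β} : Set K)) ↔
      ∃ c₀ c₁ c₂ c₃ : S, x = algebraMap S K c₀ + algebraMap S K c₁ * α +
        algebraMap S K c₂ * β + algebraMap S K c₃ * (α * β / 2) := by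
  have hmα : α ∈ Algebra.adjoin S ({α, β} : Set K) := Algebra.subset_adjoin (by simp)
  have hmβ : β ∈ Algebra.adjoin S ({α, β} : Set K) := Algebra.subset_adjoin (by simp)
  constructor
  · intro h
    obtain ⟨c₀, c₁, c₂, c₃, hc⟩ := (mem_adjoin_pair_iff hα hβ _).1 (h _ two_mem_evenIdeal)
    obtain ⟨d₀, d₁, d₂, d₃, hd⟩ := (mem_adjoin_pair_iff hα hβ _).1 (h _ (left_mem_evenIdeal hmα))
    obtain ⟨e₀, e₁, e₂, e₃, he⟩ := (mem_adjoin_pair_iff hα hβ _).1 (h _ (right_mem_evenIdeal hmβ))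
    replace hc : x * 2 = _ := hc
    simp only [map_mul, map_neg, map_ofNat] at hα hβ hd he
    -- With `2x = c₀ + c₁α + c₂β + c₃αβ`, the coordinates of `2xα` and `2xβ` are even. The first
    -- makes `c₀` and `c₂` even, the second `c₁`; `c₃` stays free, which accounts for `αβ/2`.
    obtain ⟨-, k₀, -, k₂⟩ := hind.eq (c₀ := 2 * c₁ * a) (c₁ := c₀ - 2 * c₁ * h₁)
      (c₂ := 2 * c₃ * a) (c₃ := c₂ - 2 * c₃ * h₁)
      (d₀ := 2 * d₀) (d₁ := 2 * d₁) (d₂ := 2 * d₂) (d₃ := 2 * d₃) (by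
        simp only [map_mul, map_sub, map_ofNat]
        linear_combination 2 * hd - α * hc
          - (algebraMap S K c₁ + algebraMap S K c₃ * β) * hα)
    obtain ⟨-, -, -, k₁⟩ := hind.eq (c₀ := 2 * c₂ * b) (c₁ := 2 * c₃ * b)
      (c₂ := c₀ - 2 * c₂ * h₂) (c₃ := c₁ - 2 * c₃ * h₂)
      (d₀ := 2 * e₀) (d₁ := 2 * e₁) (d₂ := 2 * e₂) (d₃ := 2 * e₃) (by
        simp only [map_mul, map_sub, map_ofNat]
        linear_combination 2 * he - β * hc
          - (algebraMap S K c₂ + algebraMap S K c₃ * α) * hβ)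
    obtain rfl : c₀ = 2 * (d₁ + c₁ * h₁) := by linear_combination k₀
    obtain rfl : c₂ = 2 * (d₃ + c₃ * h₁) := by linear_combination k₂
    obtain rfl : c₁ = 2 * (e₃ + c₃ * h₂) := by linear_combination k₁
    refine ⟨d₁ + 2 * (e₃ + c₃ * h₂) * h₁, e₃ + c₃ * h₂, d₃ + c₃ * h₁, c₃, mul_right_cancel₀ h2K ?_⟩
    rw [hc]
    simp only [map_mul, map_add, map_ofNat]
    field_simp
  · rintro ⟨c₀, c₁, c₂, c₃, rfl⟩ p hp
    rw [add_mul, mul_assoc (algebraMap S K c₃)]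
    refine add_mem (mul_mem ?_ p.2)
      (mul_mem (Subalgebra.algebraMap_mem _ _) (half_mul_mem h2K hp))
    exact add_mem (add_mem (Subalgebra.algebraMap_mem _ _)
      (mul_mem (Subalgebra.algebraMap_mem _ _) hmα)) (mul_mem (Subalgebra.algebraMap_mem _ _) hmβ)

/-- Within `S[α, β]`, multiplying `αβ/2` into `S[α, β]` characterizes `evenIdeal`. -/
theorem mem_evenIdeal_of_mul_half (h2K : (2 : K) ≠ 0) (hind : IndepQuad S α β)
    {x : Algebra.adjoin S ({α, β} : Set K)}
    (hx : (x : K) * (α * β / 2) ∈ Algebra.adjoin S ({α, β} : Set K)) :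
    x ∈ evenIdeal α β hα hβ := by
  obtain ⟨c₀, c₁, c₂, c₃, hc⟩ := (mem_adjoin_pair_iff hα hβ _).1 x.2
  obtain ⟨d₀, d₁, d₂, d₃, hd⟩ := (mem_adjoin_pair_iff hα hβ _).1 hx
  -- Apart from its constant term, `x` lies in the even ideal and so causes no denominator. Hence
  -- `c₀ · αβ/2` lies in the order, which makes `c₀` even.
  have hrest : ∃ e₀ e₁ e₂ e₃ : S, α * β / 2 * (algebraMap S K c₁ * α + algebraMap S K c₂ * β +
      algebraMap S K c₃ * (α * β)) = algebraMap S K e₀ + algebraMap S K e₁ * α +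
        algebraMap S K e₂ * β + algebraMap S K e₃ * (α * β) := by
    have hmem : x - algebraMap S _ c₀ ∈ evenIdeal α β hα hβ := by
      refine ⟨0, c₁, c₂, c₃, ?_⟩
      rw [Subalgebra.coe_sub, Subalgebra.coe_algebraMap, hc]
      simp only [mul_zero, map_zero]
      ring
    obtain ⟨e₀, e₁, e₂, e₃, he⟩ := (mem_adjoin_pair_iff hα hβ _).1 (half_mul_mem h2K hmem)
    refine ⟨e₀, e₁, e₂, e₃, ?_⟩
    rw [← he, Subalgebra.coe_sub, Subalgebra.coe_algebraMap, hc]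
    ring
  obtain ⟨e₀, e₁, e₂, e₃, he⟩ := hrest
  obtain ⟨-, -, -, k⟩ := hind.eq (c₀ := 0) (c₁ := 0) (c₂ := 0) (c₃ := c₀)
    (d₀ := 2 * (d₀ - e₀)) (d₁ := 2 * (d₁ - e₁)) (d₂ := 2 * (d₂ - e₂)) (d₃ := 2 * (d₃ - e₃)) (by
      rw [hc] at hd
      simp only [map_mul, map_sub, map_ofNat, map_zero]
      field_simp at hd he
      linear_combination hd - he)
  exact ⟨d₃ - e₃, c₁, c₂, c₃, by rw [hc, k]⟩

end Main


/-! ### Integrality of `τ`, the change of generators, and the parity of `a` and `b`. -/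

section Assembly

variable {S K : Type*} [CommRing S] [Field K] [Algebra S K]

theorem isIntegral_of_sq_eq {α : K} {s t : S}
    (h : α ^ 2 = algebraMap S K s + algebraMap S K t * α) : IsIntegral S α := by
  refine ⟨Polynomial.X ^ 2 - Polynomial.C t * Polynomial.X - Polynomial.C s, ?_, ?_⟩
  · monicity!
  · simp only [Polynomial.eval₂_sub, Polynomial.eval₂_mul, Polynomial.eval₂_C,
      Polynomial.eval₂_X_pow, Polynomial.eval₂_X]
    linear_combination h

/-- The element `αβ/2` is integral. -/
theorem isIntegral_half (h2K : (2 : K) ≠ 0) {α β : K} {a b h₁ h₂ : S}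
    (hα : α ^ 2 = algebraMap S K (2 * a) + algebraMap S K (-2 * h₁) * α)
    (hβ : β ^ 2 = algebraMap S K (2 * b) + algebraMap S K (-2 * h₂) * β) :
    IsIntegral S (α * β / 2) := by
  have hαi := isIntegral_of_sq_eq hα
  have hβi := isIntegral_of_sq_eq hβ
  have hmap : ∀ s : S, IsIntegral S (algebraMap S K s) := fun s => isIntegral_algebraMap
  have hsq : IsIntegral S (α * β / 2 - algebraMap S K (h₁ * h₂)) := by
    refine IsIntegral.of_pow two_pos ?_
    have e : (α * β / 2 - algebraMap S K (h₁ * h₂)) ^ 2 =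
        algebraMap S K (a * b + (h₁ * h₂) ^ 2) - algebraMap S K (a * h₂) * β
          - algebraMap S K (b * h₁) * α := by
      simp only [map_mul, map_neg, map_ofNat, map_add, map_pow] at hα hβ ⊢
      field_simp
      linear_combination β ^ 2 * hα +
        (2 * algebraMap S K a - 2 * algebraMap S K h₁ * α) * hβ
    rw [e]
    exact ((hmap _).sub ((hmap _).mul hβi)).sub ((hmap _).mul hαi)
  have := hsq.add (hmap (h₁ * h₂))
  rwa [sub_add_cancel] at this

/-- Translating both generators by constants changes the coordinates by a unitriangular matrix. -/
theorem IndepQuad.of_sub {L : Type*} [Field L] [Algebra S L] [Algebra L K] [IsScalarTower S L K]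
    [FaithfulSMul S L] {ω μ : K} (h : IndepQuad L ω μ) (h₁ h₂ : S) :
    IndepQuad S (ω - algebraMap S K h₁) (μ - algebraMap S K h₂) := by
  intro c₀ c₁ c₂ c₃ e
  have hST : ∀ s : S, algebraMap S K s = algebraMap L K (algebraMap S L s) :=
    IsScalarTower.algebraMap_apply S L K
  obtain ⟨k₀, k₁, k₂, k₃⟩ := h (algebraMap S L (c₀ - c₁ * h₁ - c₂ * h₂ + c₃ * h₁ * h₂))
    (algebraMap S L (c₁ - c₃ * h₂)) (algebraMap S L (c₂ - c₃ * h₁)) (algebraMap S L c₃) (by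
      simp only [← hST, map_sub, map_add, map_mul]
      linear_combination e)
  rw [FaithfulSMul.algebraMap_eq_zero_iff] at k₀ k₁ k₂ k₃
  subst k₃
  obtain rfl : c₁ = 0 := by simpa using k₁
  obtain rfl : c₂ = 0 := by simpa using k₂
  exact ⟨by simpa using k₀, rfl, rfl, rfl⟩

theorem adjoin_pair_sub (ω μ : K) (h₁ h₂ : S) :
    Algebra.adjoin S ({ω, μ} : Set K) =
      Algebra.adjoin S ({ω - algebraMap S K h₁, μ - algebraMap S K h₂} : Set K) := by
  have hm := fun (T : Subalgebra S K) (s : S) => T.algebraMap_mem s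
  refine le_antisymm (Algebra.adjoin_le ?_) (Algebra.adjoin_le ?_)
  · have i₁ : ω - algebraMap S K h₁ ∈
        Algebra.adjoin S ({ω - algebraMap S K h₁, μ - algebraMap S K h₂} : Set K) :=
      Algebra.subset_adjoin (by simp)
    have i₂ : μ - algebraMap S K h₂ ∈
        Algebra.adjoin S ({ω - algebraMap S K h₁, μ - algebraMap S K h₂} : Set K) :=
      Algebra.subset_adjoin (by simp)
    rintro x (rfl | rfl)
    · simpa using add_mem i₁ (hm _ h₁)
    · simpa using add_mem i₂ (hm _ h₂)
  · rintro x (rfl | rfl)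
    · exact sub_mem (Algebra.subset_adjoin (by simp)) (hm _ _)
    · exact sub_mem (Algebra.subset_adjoin (by simp)) (hm _ _)

/-- If `S[ω]` is integrally closed and `ω ^ 2 = h₁ ^ 2 + 2 a`, then `a` is odd. -/
theorem not_two_dvd_of_isIntegrallyClosed {L : Type*} [Field L] [Algebra S L] [Algebra L K]
    [IsScalarTower S L K] [IsDomain S] [IsFractionRing S L] (h2 : Prime (2 : S))
    (h2K : (2 : K) ≠ 0) {ω : K} {f h₁ a : S}
    (hω : ω ^ 2 = algebraMap S K f) (hf : f = h₁ ^ 2 + 2 * a)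
    (hind : ∀ c d : L, algebraMap L K c + algebraMap L K d * ω = 0 → c = 0 ∧ d = 0)
    (hcl : IsIntegrallyClosed (Algebra.adjoin S ({ω} : Set K))) : ¬ 2 ∣ a := by
  rintro ⟨a, rfl⟩
  have h2L : (2 : L) ≠ 0 := fun h => h2K (by rw [← map_ofNat (algebraMap L K), h, map_zero])
  -- If `a = 2a'`, this element is a root of `X² + h₁X - a'`. Its `ω`-coordinate `1/2` would then
  -- lie in `S`, making `2` a unit.
  have hint : IsIntegral S ((ω - algebraMap S K h₁) / 2) := by
    refine isIntegral_of_sq_eq (s := a) (t := -h₁) ?_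
    rw [hf] at hω
    simp only [map_add, map_mul, map_pow, map_ofNat, map_neg] at hω ⊢
    field_simp
    linear_combination hω
  obtain ⟨-, s, -, hs⟩ := exists_coords_of_isIntegral_sqrt (L := L) hω hind hcl
    (d₀ := -algebraMap S L h₁ / 2) (d₁ := 1 / 2) (by
      rwa [show algebraMap L K (-algebraMap S L h₁ / 2) + algebraMap L K (1 / 2) * ω =
        (ω - algebraMap S K h₁) / 2 from ?_]
      simp only [map_div₀, map_neg, map_one, map_ofNat, ← IsScalarTower.algebraMap_apply S L K]
      ring)
  refine h2.not_isUnit (isUnit_of_dvd_one ⟨s, IsFractionRing.injective S L ?_⟩)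
  rw [map_one, map_mul, ← hs, map_ofNat]
  field_simp

end Assembly

end Biquadratic

/-! ### The main theorem: parity conditions, passage to `α` and `β`, and the return to `ω, μ, τ`. -/

theorem proposition3p3
    -- `S` is a Noetherian integrally closed domain with fraction field `L` of characteristic
    -- zero, `2` is a prime element of `S`, and `S/2S` is integrally closed
    {S : Type*} [CommRing S] [IsDomain S] [IsNoetherianRing S] [IsIntegrallyClosed S]
    {L : Type*} [Field L] [Algebra S L] [IsFractionRing S L] [CharZero L]
    (h2prime : Prime (2 : S))
    (h2normal : IsIntegrallyClosed (S ⧸ Ideal.span {(2 : S)}))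
    -- `f, g` are square free nonsquares satisfying `𝒜₁`
    (f g : S)
    (hf_pow : ¬ ∃ x : S, x ^ 2 = f) (hg_pow : ¬ ∃ x : S, x ^ 2 = g)
    (hf_sf : Biquadratic.IsSquareFree f) (hg_sf : Biquadratic.IsSquareFree g)
    (hfg : Biquadratic.SatisfiesA1 ({f, g} : Set S))
    -- `f, g ∈ S^2`, with chosen presentations
    (h₁ h₂ a b : S) (hf : f = h₁ ^ 2 + 2 * a) (hg : g = h₂ ^ 2 + 2 * b)
    -- `K = L(ω, μ)`, where `ω ^ 2 = f`, `μ ^ 2 = g` and `U ^ 2 - g` is irreducible over `L(ω)`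
    {K : Type*} [Field K] [Algebra S K] [Algebra L K] [IsScalarTower S L K]
    (ω μ : K) (hω : ω ^ 2 = algebraMap S K f) (hμ : μ ^ 2 = algebraMap S K g)
    (hK : IntermediateField.adjoin L ({ω, μ} : Set K) = ⊤)
    (hirr : Irreducible (Polynomial.X ^ 2 - Polynomial.C (algebraMap S L⟮ω⟯ g) : L⟮ω⟯[X]))
    -- the hypotheses specific to this result
    (hSω : IsIntegrallyClosed (Algebra.adjoin S ({ω} : Set K)))
    (hSμ : IsIntegrallyClosed (Algebra.adjoin S ({μ} : Set K)))
    (hfg4 : f * g ∉ Biquadratic.powWedge S 2 1 2)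
    (τ : K) (hτ : τ = (μ - algebraMap S K h₂) * (ω - algebraMap S K h₁) / 2) :
    integralClosure S K = Algebra.adjoin S ({ω, μ, τ} : Set K) ∧
    (∃ B : Module.Basis (Fin 4) S (integralClosure S K),
      ∀ i, (B i : K) = (![1, ω, μ, τ] : Fin 4 → K) i) ∧
    ∃ P : Ideal (Algebra.adjoin S ({ω, μ} : Set K)),
      (P.IsPrime ∧ P.height = 1 ∧ 2 ∈ P) ∧
      (∀ Q : Ideal (Algebra.adjoin S ({ω, μ} : Set K)),
        Q.IsPrime → Q.height = 1 → 2 ∈ Q → Q = P) ∧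
      (Biquadratic.dual K P : Set K) = (integralClosure S K : Set K) ∧
      Biquadratic.conductorInto (integralClosure S K) (Algebra.adjoin S ({ω, μ} : Set K)) = P := by

  have hST : ∀ s : S, algebraMap S K s = algebraMap L K (algebraMap S L s) :=
    IsScalarTower.algebraMap_apply S L K
  have hindL : Biquadratic.IndepQuad L ω μ :=
    Biquadratic.indepQuad_of_irreducible hω hμ hf_pow hirr
  have h2K : (2 : K) ≠ 0 := by
    rw [← map_ofNat (algebraMap L K)]
    simp
  have hspan := Biquadratic.exists_coords_of_adjoin_eq_top ((hST f) ▸ hω) ((hST g) ▸ hμ) hK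
  -- Condition `𝒜₁` only concerns distinct elements. If `f = g`, then `ω = ±μ`, against
  -- independence.
  have hne : f ≠ g := by
    rintro rfl
    rcases sq_eq_sq_iff_eq_or_eq_neg.1 (hω.trans hμ.symm) with h | h
    · exact one_ne_zero (hindL 0 1 (-1) 0 (by simp [h])).2.1
    · exact one_ne_zero (hindL 0 1 1 0 (by simp [h])).2.1
  have hA1 := hfg f (by simp) g (by simp) hne
  have hodd : ¬ 2 ∣ a * h₂ ^ 2 + b * h₁ ^ 2 := by
    rintro ⟨e, he⟩
    refine hfg4 ⟨h₁ * h₂, e + a * b, ?_⟩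
    rw [hf, hg]
    push_cast
    linear_combination 2 * he
  have ha : ¬ 2 ∣ a := Biquadratic.not_two_dvd_of_isIntegrallyClosed (L := L) h2prime h2K hω hf
    (fun c d e => by
      obtain ⟨h₀, h₁, -, -⟩ := hindL c d 0 0 (by simpa using e)
      exact ⟨h₀, h₁⟩) hSω
  have hb : ¬ 2 ∣ b := Biquadratic.not_two_dvd_of_isIntegrallyClosed (L := L) h2prime h2K hμ hg
    (fun c d e => by
      obtain ⟨h₀, -, h₁, -⟩ := hindL c 0 d 0 (by simpa using e)
      exact ⟨h₀, h₁⟩) hSμ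
  have htwo : ∀ x : K, IsIntegral S x → 2 * x ∈ Algebra.adjoin S ({ω, μ} : Set K) :=
    fun x hx => hindL.two_mul_mem_adjoin hspan hω hμ hSω hSμ hA1 hx
  have hind := hindL.of_sub h₁ h₂
  have hAeq := Biquadratic.adjoin_pair_sub ω μ h₁ h₂
  rw [hAeq] at htwo ⊢
  set α := ω - algebraMap S K h₁ with hαd
  set β := μ - algebraMap S K h₂ with hβd
  have hτ' : τ = α * β / 2 := by rw [hτ, mul_comm]
  have hωα : ω = α + algebraMap S K h₁ := by rw [hαd]; ring
  have hμβ : μ = β + algebraMap S K h₂ := by rw [hβd]; ring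
  have hα : α ^ 2 = algebraMap S K (2 * a) + algebraMap S K (-2 * h₁) * α := by
    rw [hf, hωα] at hω
    simp only [map_add, map_mul, map_pow, map_ofNat, map_neg] at hω ⊢
    linear_combination hω
  have hβ : β ^ 2 = algebraMap S K (2 * b) + algebraMap S K (-2 * h₂) * β := by
    rw [hg, hμβ] at hμ
    simp only [map_add, map_mul, map_pow, map_ofNat, map_neg] at hμ ⊢
    linear_combination hμ
  have hτi : IsIntegral S τ := hτ' ▸ Biquadratic.isIntegral_half h2K hα hβ
  have hωi : IsIntegral S ω := IsIntegral.of_pow two_pos (hω ▸ isIntegral_algebraMap)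
  have hμi : IsIntegral S μ := IsIntegral.of_pow two_pos (hμ ▸ isIntegral_algebraMap)
  have hαi : IsIntegral S α := Biquadratic.isIntegral_of_sq_eq hα
  have hβi : IsIntegral S β := Biquadratic.isIntegral_of_sq_eq hβ
  have hR : ∀ x : K, x ∈ integralClosure S K ↔ ∃ c₀ c₁ c₂ c₃ : S,
      x = algebraMap S K c₀ + algebraMap S K c₁ * α + algebraMap S K c₂ * β +
        algebraMap S K c₃ * (α * β / 2) := by
    intro x
    constructor
    · intro hx
      refine Biquadratic.exists_coords_of_isIntegral h2prime h2K ?_ ?_ hind ha hb hodd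
        (hτ' ▸ hτi) htwo x hx
      · simp only [map_mul, map_ofNat, map_neg] at hα; linear_combination hα
      · simp only [map_mul, map_ofNat, map_neg] at hβ; linear_combination hβ
    · rintro ⟨c₀, c₁, c₂, c₃, rfl⟩
      have hmap : ∀ s : S, IsIntegral S (algebraMap S K s) := fun s => isIntegral_algebraMap
      exact (((hmap _).add ((hmap _).mul hαi)).add ((hmap _).mul hβi)).add
        ((hmap _).mul (hτ' ▸ hτi))
  have hR' : ∀ x : K, x ∈ integralClosure S K → ∃ c₀ c₁ c₂ c₃ : S,
      x = algebraMap S K c₀ + algebraMap S K c₁ * ω + algebraMap S K c₂ * μ +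
        algebraMap S K c₃ * τ := by
    intro x hx
    obtain ⟨c₀, c₁, c₂, c₃, rfl⟩ := (hR x).1 hx
    refine ⟨c₀ - c₁ * h₁ - c₂ * h₂, c₁, c₂, c₃, ?_⟩
    rw [hτ', hωα, hμβ]
    simp only [map_sub, map_mul]
    ring
  refine ⟨le_antisymm ?_ ?_, ?_, Biquadratic.evenIdeal α β hα hβ,
    ⟨Biquadratic.isPrime_evenIdeal hind h2prime, Biquadratic.height_evenIdeal hind h2prime h2K,
      Biquadratic.two_mem_evenIdeal⟩,
    fun Q hQ hQ1 h2Q => Biquadratic.eq_evenIdeal hind h2prime h2K hQ hQ1 h2Q, ?_, ?_⟩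
  · intro x hx
    obtain ⟨c₀, c₁, c₂, c₃, rfl⟩ := hR' x hx
    have hm : ∀ s : S, algebraMap S K s ∈ Algebra.adjoin S ({ω, μ, τ} : Set K) :=
      Subalgebra.algebraMap_mem _
    exact add_mem (add_mem (add_mem (hm _) (mul_mem (hm _) (Algebra.subset_adjoin (by simp))))
      (mul_mem (hm _) (Algebra.subset_adjoin (by simp))))
      (mul_mem (hm _) (Algebra.subset_adjoin (by simp)))
  · refine Algebra.adjoin_le ?_
    rintro x (rfl | rfl | rfl)
    exacts [hωi, hμi, hτi]
  · let v : Fin 4 → integralClosure S K := ![1, ⟨ω, hωi⟩, ⟨μ, hμi⟩, ⟨τ, hτi⟩]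
    have hsum : ∀ c : Fin 4 → S, ((∑ i, c i • v i : integralClosure S K) : K) =
        algebraMap S K (c 0) + algebraMap S K (c 1) * ω + algebraMap S K (c 2) * μ +
          algebraMap S K (c 3) * τ := by
      intro c
      simp [Fin.sum_univ_four, v, Algebra.smul_def]
    have hli : LinearIndependent S v := by
      rw [Fintype.linearIndependent_iff]
      intro c hc
      have h0 := hsum c
      rw [hc, ZeroMemClass.coe_zero, hωα, hμβ, hτ'] at h0
      -- The relation is doubled to clear the denominator of `τ = αβ/2` and rewritten in `1, α, β,
      -- αβ`.
      obtain ⟨k₀, k₁, k₂, k₃⟩ := hind (2 * (c 0 + c 1 * h₁ + c 2 * h₂)) (2 * c 1) (2 * c 2) (c 3)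
        (by
          simp only [map_mul, map_add, map_ofNat]
          field_simp at h0
          linear_combination -h0)
      have h2S := h2prime.ne_zero
      have k₁' : c 1 = 0 := by simpa [h2S] using k₁
      have k₂' : c 2 = 0 := by simpa [h2S] using k₂
      have k₀' : c 0 = 0 := by simpa [h2S, k₁', k₂'] using k₀
      intro i
      fin_cases i
      exacts [k₀', k₁', k₂', k₃]
    have hsp : ⊤ ≤ Submodule.span S (Set.range v) := by
      rintro ⟨x, hx⟩ -
      obtain ⟨c₀, c₁, c₂, c₃, hc⟩ := hR' x hx
      rw [Submodule.mem_span_range_iff_exists_fun]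
      exact ⟨![c₀, c₁, c₂, c₃], Subtype.ext ((hsum _).trans hc.symm)⟩
    refine ⟨Module.Basis.mk hli hsp, fun i => ?_⟩
    rw [Module.Basis.mk_apply]
    fin_cases i <;> rfl
  · ext x
    rw [SetLike.mem_coe, SetLike.mem_coe, hR, ← Biquadratic.forall_mul_mem_iff
      (hα := hα) (hβ := hβ) h2K hind, Biquadratic.dual, Submodule.mem_div_iff_forall_mul_mem]
    constructor
    · intro h p hp
      obtain ⟨y, hy⟩ := Submodule.mem_one.1
        (h p ((IsLocalization.mem_coeSubmodule _ _).2 ⟨p, hp, rfl⟩))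
      exact hy ▸ y.2
    · intro h y hy
      obtain ⟨p, hp, rfl⟩ := (IsLocalization.mem_coeSubmodule _ _).1 hy
      exact Submodule.mem_one.2 ⟨⟨_, h p hp⟩, rfl⟩
  · ext x
    constructor
    · intro h
      refine Biquadratic.mem_evenIdeal_of_mul_half h2K hind ?_
      exact h _ (hτ' ▸ hτi)
    · intro hx r hr
      rw [mul_comm]
      exact (Biquadratic.forall_mul_mem_iff (hα := hα) (hβ := hβ) h2K hind r).2
        ((hR r).1 hr) x hx
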